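/- Let $p\in\{4,5\}$ and let $m$ be any dimension. There is a constant $c=c(p,m)>0$, depending only on $p$ and $m$, such that for all pairwise distinct points $x_1,\dots,x_p\in\mathbb R^m$ and every $U=(u_1,\dots,u_p)^T\in\mathbb R^p$, $$|AU|^2+\sup_{1\le k\le p}\left|U^T\Big(\frac{\partial A}{\partial x_k}\Big)U\right|\;\ge\; c(p,m)\sum_{\substack{1\le i,j\le p\\ j\ne i}}\frac{u_j^2}{|x_i-x_j|^2}.$$ Here $|\cdot|$ denotes the Euclidean norm, $A=(a_{ij})$ is the $p\times p$ matrix with $a_{ii}=0$ and $a_{ij}=1/|x_i-x_j|$ for $i\ne j$, and $\partial A/\partial x_k$ is the $\mathbb R^m$-valued $p\times p$ matrix whose $(i,j)$ entry is the gradient of $a_{ij}$ with respect to $x_k$, so that $U^T(\partial A/\partial x_k)U=\sum_{i,j}u_iu_j\,\partial a_{ij}/\partial x_k\in\mathbb R^m$. -/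

import Mathlib

namespace BahriXu

/-- The `p × p` matrix `A` of a configuration `x₁, …, x_p` of points of `ℝᵐ`:
`0` on the diagonal and `1 / |x_i - x_j|` off the diagonal. -/
noncomputable def matA {p m : ℕ} (x : Fin p → EuclideanSpace ℝ (Fin m)) :
    Matrix (Fin p) (Fin p) ℝ :=
  Matrix.of fun i j => if i = j then 0 else 1 / ‖x i - x j‖

/-- The vector-valued `p × p` matrix `∂A/∂x_k`: its `(i, j)` entry is the gradient in `ℝᵐ` of the
entry `a_{ij}` as a function of the `k`-th point, the other points being fixed. -/
noncomputable def dmatA {p m : ℕ} (x : Fin p → EuclideanSpace ℝ (Fin m)) (k : Fin p) :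
    Matrix (Fin p) (Fin p) (EuclideanSpace ℝ (Fin m)) :=
  Matrix.of fun i j => gradient (fun y => matA (Function.update x k y) i j) (x k)

/-- `Uᵀ B U = ∑_{i,j} u_i u_j b_{ij}` for a vector-valued matrix `B`. -/
noncomputable def quadForm {p m : ℕ} (B : Matrix (Fin p) (Fin p) (EuclideanSpace ℝ (Fin m)))
    (U : Fin p → ℝ) : EuclideanSpace ℝ (Fin m) :=
  ∑ i, ∑ j, (U i * U j) • B i j

/-- The inequality of Bahri and Xu for `p` points of `ℝᵐ`: there is a constant `c > 0`, depending
only on `p` and `m`, such that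
`|AU|² + sup_k |Uᵀ (∂A/∂x_k) U| ≥ c ∑_{i ≠ j} u_j² / |x_i - x_j|²`
for all distinct `x₁, …, x_p` in `ℝᵐ` and all `U` in `ℝᵖ`. Norms are Euclidean. -/
def Conjecture (p m : ℕ) : Prop :=
  ∃ c : ℝ, 0 < c ∧
    ∀ x : Fin p → EuclideanSpace ℝ (Fin m), Function.Injective x →
      ∀ U : Fin p → ℝ,
        c * ∑ i, ∑ j ∈ Finset.univ.filter (fun j => j ≠ i), U j ^ 2 / ‖x i - x j‖ ^ 2 ≤
          ‖WithLp.toLp 2 ((matA x).mulVec U)‖ ^ 2 + ⨆ k : Fin p, ‖quadForm (dmatA x k) U‖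

end BahriXu

/-! The inequality is electrostatic: the entries of `AU` are the potentials at the points of charges
`U`, and `Uᵀ (∂A/∂x_k) U` is twice the force on the `k`-th charge. If no constant works, scaling `U`
gives configurations with largest ratio `|u_j| / |x_i - x_j|` equal to 1 whose potentials and forces
tend to 0. Along an ultrafilter, call a charge negligible when all its ratios tend to 0, and rescale
so that the smallest distance from a non-negligible charge is 1. The non-negligible charges that
stay at finite distance converge to a balanced cluster: nonzero charges, zero field at each, and one
common potential, since everything outside the cluster contributes only a constant potential in the
limit. It remains to exclude balanced clusters of 2, 3 or 4 charges, and of 5 at potential 0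
(`IsBalanced.card_le_one`). Inversion centred at one charge turns `n + 1` charges at potential 0
into `n` balanced charges, which takes 5 to 4. For 4 charges at nonzero potential it yields a
four-charge equilibrium, and `four_charges` then forces a regular tetrahedron, where the field
cannot vanish. A cluster of one charge is ruled out by the potential at its nearest neighbour. -/

namespace BahriXu

open scoped RealInnerProductSpace
open Filter Topology

/-! ### Four charges in equilibrium: products of opposite distances. -/

section Exact

variable {E : Type*} [NormedAddCommGroup E] [InnerProductSpace ℝ E]

/-- If two rank-two quadratic forms given as products of linear functionals agree, then so do
the products of the norms of the functionals. -/
theorem abs_mul_norm_mul_norm_eq [FiniteDimensional ℝ E] {μ ν : ℝ} {p q r s : E}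
    (h : ∀ l : E, μ * (⟪l, p⟫ * ⟪l, q⟫) = ν * (⟪l, r⟫ * ⟪l, s⟫)) :
    |μ| * (‖p‖ * ‖q‖) = |ν| * (‖r‖ * ‖s‖) := by
  have polar : ∀ l l' : E, μ * (⟪l, p⟫ * ⟪l', q⟫ + ⟪l', p⟫ * ⟪l, q⟫) =
      ν * (⟪l, r⟫ * ⟪l', s⟫ + ⟪l', r⟫ * ⟪l, s⟫) := by
    intro l l'
    have h1 := h (l + l')
    simp only [inner_add_left] at h1
    linear_combination h1 - h l - h l'
  -- The two forms share their trace and, by polarisation at `(p, q)` and `(r, s)`, their Frobenius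
  -- norm, which involves `‖p‖² ‖q‖² + ⟪p, q⟫²`; subtracting the squared traces leaves the products
  -- of norms.
  have tr : μ * ⟪p, q⟫ = ν * ⟪r, s⟫ := by
    let b := stdOrthonormalBasis ℝ E
    rw [← b.sum_inner_mul_inner p q, ← b.sum_inner_mul_inner r s, Finset.mul_sum, Finset.mul_sum]
    refine Finset.sum_congr rfl fun i _ => ?_
    rw [real_inner_comm (b i) p, real_inner_comm (b i) r]
    exact h (b i)
  have e1 := polar p q
  have e2 := polar r s
  simp only [real_inner_self_eq_norm_sq] at e1 e2
  rw [real_inner_comm p q] at e1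
  rw [real_inner_comm r s] at e2
  have c1 := real_inner_comm p r
  have c2 := real_inner_comm p s
  have c3 := real_inner_comm q r
  have c4 := real_inner_comm q s
  rw [c1, c2, c3, c4] at e2
  have key : (μ * (‖p‖ * ‖q‖)) ^ 2 = (ν * (‖r‖ * ‖s‖)) ^ 2 := by
    linear_combination μ * e1 + ν * e2 - (μ * ⟪p, q⟫ + ν * ⟪r, s⟫) * tr
  have := (sq_eq_sq_iff_abs_eq_abs _ _).1 key
  simpa only [abs_mul, abs_norm] using this

/-- The Pfaffian relations of an equilibrium stress on four points. -/
theorem stress_relations [FiniteDimensional ℝ E] {a b c d : E} {s₁₂ s₁₃ s₁₄ s₂₃ s₂₄ s₃₄ : ℝ}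
    (h₁ : s₁₂ • (b - a) + s₁₃ • (c - a) + s₁₄ • (d - a) = 0)
    (h₂ : s₁₂ • (a - b) + s₂₃ • (c - b) + s₂₄ • (d - b) = 0)
    (h₃ : s₁₃ • (a - c) + s₂₃ • (b - c) + s₃₄ • (d - c) = 0) :
    |s₁₂ * s₃₄ - s₁₄ * s₂₃| * (‖b - a‖ * ‖d - c‖) =
        |s₁₃ * s₂₄ - s₁₄ * s₂₃| * (‖c - a‖ * ‖d - b‖) ∧
      |s₁₂ * s₃₄ - s₁₃ * s₂₄| * (‖c - a‖ * ‖d - b‖) =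
        |s₁₂ * s₃₄ - s₁₄ * s₂₃| * (‖d - a‖ * ‖c - b‖) := by
  -- Projected to a line, the coordinates satisfy `(b-a)(d-c) - (c-a)(d-b) + (d-a)(c-b) = 0`.
  -- Combined with this stress-weighted version, it allows the third product, then the first, to be
  -- eliminated.
  have pf : ∀ l : E, s₁₂ * s₃₄ * (⟪l, b - a⟫ * ⟪l, d - c⟫)
      - s₁₃ * s₂₄ * (⟪l, c - a⟫ * ⟪l, d - b⟫) + s₁₄ * s₂₃ * (⟪l, d - a⟫ * ⟪l, c - b⟫) = 0 := by
    intro l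
    have g₁ := congrArg (fun v => ⟪l, v⟫) h₁
    have g₂ := congrArg (fun v => ⟪l, v⟫) h₂
    have g₃ := congrArg (fun v => ⟪l, v⟫) h₃
    simp only [inner_add_right, inner_sub_right, inner_smul_right, inner_zero_right] at g₁ g₂ g₃ ⊢
    linear_combination (s₂₃ * (⟪l, c⟫ - ⟪l, b⟫)) * g₁ + (-s₁₃ * (⟪l, c⟫ - ⟪l, a⟫)) * g₂ +
      (s₁₂ * (⟪l, b⟫ - ⟪l, a⟫)) * g₃
  constructor
  · refine abs_mul_norm_mul_norm_eq fun l => ?_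
    have := pf l
    simp only [inner_sub_right] at this ⊢
    linear_combination this
  · refine abs_mul_norm_mul_norm_eq fun l => ?_
    have := pf l
    simp only [inner_sub_right] at this ⊢
    linear_combination this

/-- The gaps `g - h`, `f - h`, `f - g` are proportional to `X`, `Y`, `Z`. The widest gap `f - h`
goes with the middle number `Y`, although `Z` is at least as large; hence `g = h`, and then all gaps
vanish. -/
theorem eq_of_abs_relations_of_le {X Y Z f g h : ℝ} (hX : 0 < X) (hXY : X ≤ Y) (hYZ : Y ≤ Z)
    (hfg : g ≤ f) (hgh : h ≤ g) (h₁ : |f - h| * X = |g - h| * Y) (h₂ : |f - g| * Y = |f - h| * Z) :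
    f = g ∧ g = h := by
  rw [abs_of_nonneg (by linarith), abs_of_nonneg (by linarith)] at h₁ h₂
  have hY : 0 < Y := hX.trans_le hXY
  have hgh' : g = h := by nlinarith
  subst hgh'
  have : (f - g) * X = 0 := by rw [h₁]; ring
  rcases mul_eq_zero.1 this with h | h
  · exact ⟨by linarith, rfl⟩
  · exact absurd h hX.ne'

/-- The proportionality of gaps is symmetric in the three numbers, once completed by the third
relation `h₃`, so the ordered case applies after sorting. -/
theorem eq_of_cube_relations {X Y Z : ℝ} (hX : 0 < X) (hY : 0 < Y) (hZ : 0 < Z)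
    (h₁ : |1 / X ^ 3 - 1 / Z ^ 3| * X = |1 / Y ^ 3 - 1 / Z ^ 3| * Y)
    (h₂ : |1 / X ^ 3 - 1 / Y ^ 3| * Y = |1 / X ^ 3 - 1 / Z ^ 3| * Z) : X = Y ∧ Y = Z := by
  have anti : ∀ {s t : ℝ}, 0 < s → s ≤ t → 1 / t ^ 3 ≤ 1 / s ^ 3 := fun hs hst =>
    one_div_le_one_div_of_le (by positivity) (pow_le_pow_left₀ hs.le hst 3)
  have inj : ∀ {s t : ℝ}, 0 < s → 0 < t → 1 / s ^ 3 = 1 / t ^ 3 → s = t := fun hs ht hst => by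
    rw [one_div, one_div, inv_inj] at hst
    exact (pow_left_inj₀ hs.le ht.le (by norm_num)).1 hst
  have h₃ : |1 / X ^ 3 - 1 / Y ^ 3| * X = |1 / Y ^ 3 - 1 / Z ^ 3| * Z := by
    have : Y * (|1 / X ^ 3 - 1 / Y ^ 3| * X - |1 / Y ^ 3 - 1 / Z ^ 3| * Z) = 0 := by
      linear_combination X * h₂ + Z * h₁
    rcases mul_eq_zero.1 this with h | h
    · exact absurd h hY.ne'
    · linarith
  have cXY := abs_sub_comm (1 / X ^ 3) (1 / Y ^ 3)
  have cXZ := abs_sub_comm (1 / X ^ 3) (1 / Z ^ 3)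
  have cYZ := abs_sub_comm (1 / Y ^ 3) (1 / Z ^ 3)
  suffices 1 / X ^ 3 = 1 / Y ^ 3 ∧ 1 / Y ^ 3 = 1 / Z ^ 3 from ⟨inj hX hY this.1, inj hY hZ this.2⟩
  rcases le_total X Y with a | a <;> rcases le_total Y Z with b | b <;>
    rcases le_total X Z with c | c
  · have := eq_of_abs_relations_of_le hX a b (anti hX a) (anti hY b) h₁ h₂
    exact ⟨this.1, this.2⟩
  · have := eq_of_abs_relations_of_le hX a b (anti hX a) (anti hY b) h₁ h₂
    exact ⟨this.1, this.2⟩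
  · have := eq_of_abs_relations_of_le hX c b (anti hX c) (anti hZ b)
      (by rw [← cYZ]; exact h₃) (by rw [h₂])
    exact ⟨this.1.trans this.2, this.2.symm⟩
  · have := eq_of_abs_relations_of_le hZ c a (anti hZ c) (anti hX a)
      (by rw [← cYZ, h₃]) (by rw [← cXZ, ← cYZ, h₁])
    exact ⟨this.2, (this.1.trans this.2).symm⟩
  · have := eq_of_abs_relations_of_le hY a c (anti hY a) (anti hX c)
      (by rw [h₁]) (by rw [← cXY, h₃])
    exact ⟨this.1.symm, this.1.trans this.2⟩
  · have := eq_of_abs_relations_of_le hY b c (anti hY b) (anti hZ c)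
      (by rw [← cXY, ← cXZ, h₂]) (by rw [← cXY, h₃])
    exact ⟨(this.1.trans this.2).symm, this.1⟩
  · have := eq_of_abs_relations_of_le hZ b a (anti hZ b) (anti hY a)
      (by rw [← cXZ, ← cXY, h₂]) (by rw [← cXZ, ← cYZ, h₁])
    exact ⟨this.2.symm, this.1.symm⟩
  · have := eq_of_abs_relations_of_le hZ b a (anti hZ b) (anti hY a)
      (by rw [← cXZ, ← cXY, h₂]) (by rw [← cXZ, ← cYZ, h₁])
    exact ⟨this.2.symm, this.1.symm⟩

/-- Four nonzero charges in equilibrium have equal products of opposite distances. -/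
theorem four_charges [FiniteDimensional ℝ E] {a b c d : E} {w₁ w₂ w₃ w₄ : ℝ}
    (hab : b ≠ a) (hac : c ≠ a) (had : d ≠ a) (hbc : c ≠ b) (hbd : d ≠ b) (hcd : d ≠ c)
    (hw₁ : w₁ ≠ 0) (hw₂ : w₂ ≠ 0) (hw₃ : w₃ ≠ 0) (hw₄ : w₄ ≠ 0)
    (h₁ : (w₂ / ‖b - a‖ ^ 3) • (b - a) + (w₃ / ‖c - a‖ ^ 3) • (c - a)
      + (w₄ / ‖d - a‖ ^ 3) • (d - a) = 0)
    (h₂ : (w₁ / ‖b - a‖ ^ 3) • (a - b) + (w₃ / ‖c - b‖ ^ 3) • (c - b)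
      + (w₄ / ‖d - b‖ ^ 3) • (d - b) = 0)
    (h₃ : (w₁ / ‖c - a‖ ^ 3) • (a - c) + (w₂ / ‖c - b‖ ^ 3) • (b - c)
      + (w₄ / ‖d - c‖ ^ 3) • (d - c) = 0) :
    ‖b - a‖ * ‖d - c‖ = ‖c - a‖ * ‖d - b‖ ∧ ‖c - a‖ * ‖d - b‖ = ‖d - a‖ * ‖c - b‖ := by
  have key := stress_relations (a := a) (b := b) (c := c) (d := d)
    -- Multiplying each field equation by its own charge makes the coefficients symmetric. The
    -- product of two opposite stresses is then `w₁ w₂ w₃ w₄` over the cube of the product of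
    -- opposite distances.
    (s₁₂ := w₁ * w₂ / ‖b - a‖ ^ 3) (s₁₃ := w₁ * w₃ / ‖c - a‖ ^ 3) (s₁₄ := w₁ * w₄ / ‖d - a‖ ^ 3)
    (s₂₃ := w₂ * w₃ / ‖c - b‖ ^ 3) (s₂₄ := w₂ * w₄ / ‖d - b‖ ^ 3) (s₃₄ := w₃ * w₄ / ‖d - c‖ ^ 3)
    (by have := congrArg (fun v => w₁ • v) h₁
        simpa only [smul_add, smul_smul, mul_div_assoc, smul_zero] using this)
    (by have := congrArg (fun v => w₂ • v) h₂
        simp only [smul_add, smul_smul, mul_div_assoc, smul_zero] at this ⊢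
        rw [← this]; congr 3; ring)
    (by have := congrArg (fun v => w₃ • v) h₃
        simp only [smul_add, smul_smul, mul_div_assoc, smul_zero] at this ⊢
        rw [← this]; congr 3 <;> ring_nf)
  have p₁ := norm_pos_iff.2 (sub_ne_zero.2 hab)
  have p₂ := norm_pos_iff.2 (sub_ne_zero.2 hac)
  have p₃ := norm_pos_iff.2 (sub_ne_zero.2 had)
  have p₄ := norm_pos_iff.2 (sub_ne_zero.2 hbc)
  have p₅ := norm_pos_iff.2 (sub_ne_zero.2 hbd)
  have p₆ := norm_pos_iff.2 (sub_ne_zero.2 hcd)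
  generalize ‖b - a‖ = r₁ at *
  generalize ‖c - a‖ = r₂ at *
  generalize ‖d - a‖ = r₃ at *
  generalize ‖c - b‖ = r₄ at *
  generalize ‖d - b‖ = r₅ at *
  generalize ‖d - c‖ = r₆ at *
  set W := w₁ * w₂ * w₃ * w₄ with hW
  have hW0 : |W| ≠ 0 := by simp [hW, hw₁, hw₂, hw₃, hw₄]
  have e₁ : w₁ * w₂ / r₁ ^ 3 * (w₃ * w₄ / r₆ ^ 3) = W * (1 / (r₁ * r₆) ^ 3) := by
    rw [hW]; field_simp
  have e₂ : w₁ * w₃ / r₂ ^ 3 * (w₂ * w₄ / r₅ ^ 3) = W * (1 / (r₂ * r₅) ^ 3) := by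
    rw [hW]; field_simp
  have e₃ : w₁ * w₄ / r₃ ^ 3 * (w₂ * w₃ / r₄ ^ 3) = W * (1 / (r₃ * r₄) ^ 3) := by
    rw [hW]; field_simp
  rw [e₁, e₂, e₃] at key
  simp only [← mul_sub, abs_mul, mul_assoc |W|] at key
  have k₁ := mul_left_cancel₀ hW0 key.1
  have k₂ := mul_left_cancel₀ hW0 key.2
  exact eq_of_cube_relations (mul_pos p₁ p₆) (mul_pos p₂ p₅) (mul_pos p₃ p₄) k₁ k₂

end Exact

/-! ### Balanced configurations and their behaviour under inversion. -/

section Balanced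

variable {E : Type*} [NormedAddCommGroup E] [InnerProductSpace ℝ E] {ι κ : Type*} [Fintype ι]
  [Fintype κ]

/-- The potential at the `i`-th point of charges `w` located at `y`. -/
noncomputable def potential (y : ι → E) (w : ι → ℝ) (i : ι) : ℝ :=
  -- The term `j = i` is a division by zero, hence 0: there is no self-interaction.
  ∑ j, w j / ‖y i - y j‖

/-- The (negative of the) electric field at the `i`-th point of charges `w` located at `y`. -/
noncomputable def field (y : ι → E) (w : ι → ℝ) (i : ι) : E :=
  ∑ j, (w j / ‖y i - y j‖ ^ 3) • (y j - y i)

/-- Nonzero charges at distinct points, in equilibrium, all at the potential `c`. -/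
structure IsBalanced (y : ι → E) (w : ι → ℝ) (c : ℝ) : Prop where
  injective : Function.Injective y
  charge_ne_zero : ∀ i, w i ≠ 0
  potential_eq : ∀ i, potential y w i = c
  field_eq : ∀ i, field y w i = 0

theorem IsBalanced.comp_equiv {y : ι → E} {w : ι → ℝ} {c : ℝ} (h : IsBalanced y w c)
    (e : κ ≃ ι) : IsBalanced (y ∘ e) (w ∘ e) c where
  injective := h.injective.comp e.injective
  charge_ne_zero i := h.charge_ne_zero (e i)
  potential_eq i := by
    rw [← h.potential_eq (e i)]
    exact Equiv.sum_comp e fun j => w j / ‖y (e i) - y j‖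
  field_eq i := by
    rw [← h.field_eq (e i)]
    exact Equiv.sum_comp e fun j => (w j / ‖y (e i) - y j‖ ^ 3) • (y j - y (e i))

theorem IsBalanced.sub_const {y : ι → E} {w : ι → ℝ} {c : ℝ} (h : IsBalanced y w c)
    (v : E) : IsBalanced (fun i => y i - v) w c where
  injective i j hij := h.injective (sub_left_injective hij)
  charge_ne_zero := h.charge_ne_zero
  potential_eq i := by
    rw [← h.potential_eq i]; simp only [potential, sub_sub_sub_cancel_right]
  field_eq i := by
    rw [← h.field_eq i]; simp only [field, sub_sub_sub_cancel_right]

/-- Inversion in the unit sphere. -/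
noncomputable def sphInv (v : E) : E := (1 / ‖v‖) ^ 2 • v

theorem norm_sphInv (v : E) : ‖sphInv v‖ = 1 / ‖v‖ := by
  rcases eq_or_ne v 0 with rfl | hv
  · simp [sphInv]
  · have := norm_pos_iff.2 hv
    rw [sphInv, norm_smul, Real.norm_of_nonneg (by positivity)]
    field_simp

theorem norm_sphInv_sub_sphInv {v w : E} (hv : v ≠ 0) (hw : w ≠ 0) :
    ‖sphInv v - sphInv w‖ = ‖v - w‖ / (‖v‖ * ‖w‖) := by
  have := dist_div_norm_sq_smul hv hw 1
  rw [dist_eq_norm, dist_eq_norm] at this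
  rw [sphInv, sphInv, this]
  ring

theorem sphInv_injOn : Set.InjOn (sphInv : E → E) {0}ᶜ := by
  intro v hv w hw h
  have := norm_sphInv_sub_sphInv hv hw
  rw [h, sub_self, norm_zero, eq_comm, div_eq_zero_iff] at this
  rcases this with h' | h'
  · exact sub_eq_zero.1 (norm_eq_zero.1 h')
  · exact absurd h' (mul_ne_zero (norm_ne_zero_iff.2 hv) (norm_ne_zero_iff.2 hw))

theorem sphInv_ne_zero {v : E} (hv : v ≠ 0) : sphInv v ≠ 0 :=
  smul_ne_zero (pow_ne_zero _ (one_div_ne_zero (norm_ne_zero_iff.2 hv))) hv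

theorem potential_sphInv {y : ι → E} (hy : ∀ i, y i ≠ 0) (w : ι → ℝ) (i : ι) :
    potential (fun j => sphInv (y j)) (fun j => w j / ‖y j‖) i = ‖y i‖ * potential y w i := by
  simp only [potential, Finset.mul_sum]
  refine Finset.sum_congr rfl fun j _ => ?_
  have h₁ := norm_ne_zero_iff.2 (hy i)
  have h₂ := norm_ne_zero_iff.2 (hy j)
  rw [norm_sphInv_sub_sphInv (hy i) (hy j)]
  rcases eq_or_ne ‖y i - y j‖ 0 with h | h
  · simp [h]
  · field_simp

/-- The field is covariant under the Kelvin transform up to a radial term, which the potential and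
the radial field determine. -/
theorem field_sphInv {y : ι → E} (hy : ∀ i, y i ≠ 0) (w : ι → ℝ) (i : ι) :
    field (fun j => sphInv (y j)) (fun j => w j / ‖y j‖) i =
      ‖y i‖ ^ 3 • field y w i -
        (‖y i‖ * (potential y w i + 2 * ⟪y i, field y w i⟫)) • y i := by
  have h₁ := norm_ne_zero_iff.2 (hy i)
  simp only [field, potential, inner_sum, Finset.mul_sum, ← Finset.sum_add_distrib, Finset.sum_smul,
    Finset.smul_sum, ← Finset.sum_sub_distrib]
  refine Finset.sum_congr rfl fun j _ => ?_
  have h₂ := norm_ne_zero_iff.2 (hy j)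
  rw [norm_sphInv_sub_sphInv (hy i) (hy j)]
  rcases eq_or_ne ‖y i - y j‖ 0 with h | h
  · have : y j - y i = 0 := by rw [← neg_sub, neg_eq_zero]; exact norm_eq_zero.1 h
    simp [h, this]
  · have hj : ‖y j‖ ^ 2 = ‖y i‖ ^ 2 + 2 * ⟪y i, y j - y i⟫ + ‖y i - y j‖ ^ 2 := by
      rw [norm_sub_rev (y i), ← norm_add_sq_real, add_sub_cancel]
    have hin : sphInv (y j) - sphInv (y i) = (1 / ‖y j‖) ^ 2 • (y j - y i) +
        ((1 / ‖y j‖) ^ 2 - (1 / ‖y i‖) ^ 2) • y i := by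
      simp only [sphInv]; module
    rw [hin, inner_smul_right, smul_add, smul_smul, smul_smul, smul_smul, sub_eq_add_neg (_ • _),
      ← neg_smul]
    congr 2
    · field_simp
    · have : ⟪y i, y j - y i⟫ = (‖y j‖ ^ 2 - ‖y i‖ ^ 2 - ‖y i - y j‖ ^ 2) / 2 := by
        rw [hj]; ring
      rw [this]
      field_simp
      ring

/-- Inversion exchanges a charge `q` at the centre of inversion and the external potential. -/
theorem potential_sphInv_of_eq {y : ι → E} (hy : ∀ i, y i ≠ 0) {w : ι → ℝ} {i : ι} {q c : ℝ}
    (hp : q / ‖y i‖ + potential y w i = c) :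
    -c / ‖sphInv (y i)‖ + potential (fun j => sphInv (y j)) (fun j => w j / ‖y j‖) i = -q := by
  have h₁ := norm_ne_zero_iff.2 (hy i)
  rw [potential_sphInv hy, norm_sphInv, ← hp]
  field_simp
  ring

/-- In equilibrium with a charge `q` at the centre, the contributions of `q` cancel and the radial
term is exactly balanced by a charge `-c` at the centre. -/
theorem field_sphInv_of_eq {y : ι → E} (hy : ∀ i, y i ≠ 0) {w : ι → ℝ} {i : ι} {q c : ℝ}
    (hp : q / ‖y i‖ + potential y w i = c)
    (hf : (q / ‖y i‖ ^ 3) • (0 - y i) + field y w i = 0) :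
    (-c / ‖sphInv (y i)‖ ^ 3) • (0 - sphInv (y i)) +
      field (fun j => sphInv (y j)) (fun j => w j / ‖y j‖) i = 0 := by
  have h₁ := norm_ne_zero_iff.2 (hy i)
  have hf' : field y w i = (q / ‖y i‖ ^ 3) • y i := by
    rw [zero_sub, smul_neg] at hf
    exact (neg_add_eq_zero.1 hf).symm
  have hp' : potential y w i = c - q / ‖y i‖ := by rw [← hp]; ring
  rw [field_sphInv hy, hf', hp', norm_sphInv, sphInv, inner_smul_right, real_inner_self_eq_norm_sq,
    zero_sub,
    ← smul_neg, smul_smul, smul_smul, ← sub_smul, smul_neg, ← sub_eq_neg_add, ← sub_smul]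
  convert zero_smul ℝ (y i)
  field_simp
  ring

omit [InnerProductSpace ℝ E] in
theorem potential_succ {n : ℕ} (y : Fin (n + 1) → E) (w : Fin (n + 1) → ℝ) (i : Fin n) :
    potential y w i.succ = w 0 / ‖y i.succ - y 0‖ +
      potential (fun j : Fin n => y j.succ) (fun j => w j.succ) i :=
  Fin.sum_univ_succ _

theorem field_succ {n : ℕ} (y : Fin (n + 1) → E) (w : Fin (n + 1) → ℝ) (i : Fin n) :
    field y w i.succ = (w 0 / ‖y i.succ - y 0‖ ^ 3) • (y 0 - y i.succ) +
      field (fun j : Fin n => y j.succ) (fun j => w j.succ) i :=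
  Fin.sum_univ_succ _

/-- The charges other than the zeroth one after inversion centred at the zeroth one. -/
theorem IsBalanced.inversion {n : ℕ} {y : Fin (n + 1) → E} {w : Fin (n + 1) → ℝ} {c : ℝ}
    (h : IsBalanced y w c) (i : Fin n) :
    -c / ‖sphInv (y i.succ - y 0)‖ + potential (fun j : Fin n => sphInv (y j.succ - y 0))
        (fun j => w j.succ / ‖y j.succ - y 0‖) i = -w 0 ∧
      (-c / ‖sphInv (y i.succ - y 0)‖ ^ 3) • (0 - sphInv (y i.succ - y 0)) +
        field (fun j : Fin n => sphInv (y j.succ - y 0))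
          (fun j => w j.succ / ‖y j.succ - y 0‖) i = 0 := by
  have h' := h.sub_const (y 0)
  have hy : ∀ j : Fin n, y j.succ - y 0 ≠ 0 := fun j =>
    sub_ne_zero.2 (h.injective.ne (Fin.succ_ne_zero j))
  have hp := h'.potential_eq i.succ
  have hf := h'.field_eq i.succ
  rw [potential_succ, sub_self, sub_zero] at hp
  rw [field_succ, sub_self, sub_zero] at hf
  exact ⟨potential_sphInv_of_eq hy hp, field_sphInv_of_eq hy hp hf⟩

/-- The charge `-c` that inversion places at the centre is zero here, so one charge disappears and
the others stay balanced. -/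
theorem IsBalanced.of_potential_zero {n : ℕ} {y : Fin (n + 1) → E} {w : Fin (n + 1) → ℝ}
    (h : IsBalanced y w 0) :
    IsBalanced (fun j : Fin n => sphInv (y j.succ - y 0)) (fun j => w j.succ / ‖y j.succ - y 0‖)
      (-w 0) where
  injective i j hij := by
    have hy : ∀ j : Fin n, y j.succ - y 0 ≠ 0 := fun j =>
      sub_ne_zero.2 (h.injective.ne (Fin.succ_ne_zero j))
    exact Fin.succ_injective _ (h.injective (sub_left_injective (sphInv_injOn (hy i) (hy j) hij)))
  charge_ne_zero j := div_ne_zero (h.charge_ne_zero _)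
    (norm_ne_zero_iff.2 (sub_ne_zero.2 (h.injective.ne (Fin.succ_ne_zero j))))
  potential_eq i := by simpa using (h.inversion i).1
  field_eq i := by simpa using (h.inversion i).2

/-! ### Nonexistence of balanced configurations of few charges. -/

theorem not_isBalanced_two (y : Fin 2 → E) (w : Fin 2 → ℝ) (c : ℝ) : ¬ IsBalanced y w c := by
  intro h
  have hf := h.field_eq 0
  have hy : y 1 - y 0 ≠ 0 := sub_ne_zero.2 (h.injective.ne (by decide))
  have hw := h.charge_ne_zero 1
  have hn : ‖y 0 - y 1‖ ≠ 0 := norm_ne_zero_iff.2 (sub_ne_zero.2 (h.injective.ne (by decide)))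
  simp [field, Fin.sum_univ_two, hy, hw, hn] at hf

theorem not_isBalanced_three (y : Fin 3 → E) (w : Fin 3 → ℝ) (c : ℝ) : ¬ IsBalanced y w c := by
  intro h
  have h02 : y 2 - y 0 ≠ 0 := sub_ne_zero.2 (h.injective.ne (by decide))
  have h01 : y 1 - y 0 ≠ 0 := sub_ne_zero.2 (h.injective.ne (by decide))
  have h12 : y 2 - y 1 ≠ 0 := sub_ne_zero.2 (h.injective.ne (by decide))
  have w0 := h.charge_ne_zero 0
  have w1 := h.charge_ne_zero 1
  have w2 := h.charge_ne_zero 2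
  have f0 := h.field_eq 0
  have f1 := h.field_eq 1
  have p0 := h.potential_eq 0
  have p1 := h.potential_eq 1
  have p2 := h.potential_eq 2
  simp only [field, potential, Fin.sum_univ_three, sub_self, norm_zero, smul_zero, add_zero,
    zero_add, div_zero, norm_sub_rev (y 0), norm_sub_rev (y 1) (y 2)] at f0 f1 p0 p1 p2
  have hn01 := norm_pos_iff.2 h01
  have hn02 := norm_pos_iff.2 h02
  -- Vanishing of the field at `y 0` makes the points collinear. The fields fix the charge ratios in
  -- terms of `s`, and equality of potentials then fails by a nonvanishing polynomial, in each of
  -- the three cases for the middle point.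
  obtain ⟨s, hs⟩ : ∃ s : ℝ, y 1 - y 0 = s • (y 2 - y 0) := by
    refine ⟨-(w 2 / ‖y 2 - y 0‖ ^ 3) / (w 1 / ‖y 1 - y 0‖ ^ 3), ?_⟩
    have ha : w 1 / ‖y 1 - y 0‖ ^ 3 ≠ 0 := by positivity
    rw [← sub_eq_zero, ← smul_right_injective E ha |>.eq_iff, smul_sub, smul_smul,
      mul_div_cancel₀ _ ha, smul_zero, ← f0]
    module
  have hs' : y 2 - y 1 = (1 - s) • (y 2 - y 0) := by
    rw [sub_smul, ← hs]; module
  have hs0 : s ≠ 0 := by rintro rfl; simp [h01] at hs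
  have hs1 : 1 - s ≠ 0 := by intro h0; rw [h0, zero_smul] at hs'; exact h12 hs'
  rw [← neg_sub (y 1) (y 0)] at f1
  rw [hs', hs, norm_smul, norm_smul] at f1
  rw [hs, norm_smul] at f0 p0
  rw [hs, hs', norm_smul, norm_smul] at p1
  rw [hs', norm_smul] at p2
  set e := y 2 - y 0
  set R := ‖e‖
  simp only [Real.norm_eq_abs] at f0 f1 p0 p1 p2
  have g0 : w 1 / (|s| * R) ^ 3 * s + w 2 / R ^ 3 = 0 := by
    rw [smul_smul, ← add_smul] at f0
    exact (smul_eq_zero.1 f0).resolve_right h02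
  have g1 : -(w 0 / (|s| * R) ^ 3 * s) + w 2 / (|1 - s| * R) ^ 3 * (1 - s) = 0 := by
    rw [← smul_neg, smul_smul, smul_smul, smul_neg, ← sub_eq_neg_add, ← sub_smul] at f1
    have := (smul_eq_zero.1 f1).resolve_right h02
    linarith
  have hR : R ≠ 0 := hn02.ne'
  have hw1 : w 1 = -(|s| * s) * w 2 := by
    have := abs_ne_zero.2 hs0
    have h3 : |s| ^ 3 = |s| * s ^ 2 := by rw [← sq_abs s]; ring
    field_simp at g0
    rw [h3] at g0
    refine mul_right_cancel₀ hs0 ?_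
    linear_combination g0
  have hw0 : w 0 * (|1 - s| * (1 - s)) = |s| * s * w 2 := by
    have := abs_ne_zero.2 hs0
    have := abs_ne_zero.2 hs1
    have h3 : |s| ^ 3 = |s| * s ^ 2 := by rw [← sq_abs s]; ring
    have h4 : |1 - s| ^ 3 = |1 - s| * (1 - s) ^ 2 := by rw [← sq_abs (1 - s)]; ring
    field_simp at g1
    rw [h3, h4] at g1
    refine mul_right_cancel₀ hs0 (mul_right_cancel₀ hs1 ?_)
    linear_combination -g1
  have q01 : (w 1 + |s| * w 2) * |1 - s| = w 0 * |1 - s| + w 2 * |s| := by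
    have := abs_ne_zero.2 hs0
    have := abs_ne_zero.2 hs1
    have q := p0.trans p1.symm
    field_simp at q
    linear_combination q
  have q02 : (w 1 + |s| * w 2) * |1 - s| = |s| * (w 0 * |1 - s| + w 1) := by
    have := abs_ne_zero.2 hs0
    have := abs_ne_zero.2 hs1
    have q := p0.trans p2.symm
    field_simp at q
    linear_combination q
  clear_value e R
  rcases lt_or_gt_of_ne hs0 with hneg | hpos
  · rw [abs_of_neg hneg, abs_of_pos (by linarith)] at *
    have : s * w 2 * (1 - 3 * s + 3 * s ^ 2) = 0 := by
      rw [hw1] at q02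
      linear_combination -(1 - s) * q02 + s * hw0
    have h' : (1 - 3 * s + 3 * s ^ 2) ≠ 0 := by nlinarith [sq_nonneg (2 * s - 1)]
    exact mul_ne_zero (mul_ne_zero hs0 w2) h' this
  · rcases lt_or_gt_of_ne hs1 with h1 | h1
    · rw [abs_of_pos hpos, abs_of_neg h1] at *
      have : s * w 2 * (s ^ 2 + s + 1) = 0 := by
        rw [hw1] at q01 q02
        linear_combination q02 - q01 - hw0
      have h' : s ^ 2 + s + 1 ≠ 0 := by positivity
      exact mul_ne_zero (mul_ne_zero hs0 w2) h' this
    · rw [abs_of_pos hpos, abs_of_pos h1] at *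
      have : s * s * w 2 * (3 - 3 * s + s ^ 2) = 0 := by
        rw [hw1] at q01
        linear_combination -(1 - s) * q01 - hw0
      have h' : (3 - 3 * s + s ^ 2) ≠ 0 := by nlinarith [sq_nonneg (2 * s - 3)]
      exact mul_ne_zero (mul_ne_zero (mul_ne_zero hs0 hs0) w2) h' this

/-- Inversion at `y 0` gives three charges in equilibrium with a charge `-c ≠ 0` at the origin. In
the products of opposite distances from `four_charges`, the distances to `y 0` form a common factor
and cancel. -/
theorem IsBalanced.equilateral [FiniteDimensional ℝ E] {y : Fin 4 → E} {w : Fin 4 → ℝ} {c : ℝ}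
    (h : IsBalanced y w c) (hc : c ≠ 0) :
    ‖y 2 - y 1‖ = ‖y 3 - y 1‖ ∧ ‖y 3 - y 1‖ = ‖y 3 - y 2‖ := by
  have h1 : y 1 - y 0 ≠ 0 := sub_ne_zero.2 (h.injective.ne (by decide))
  have h2 : y 2 - y 0 ≠ 0 := sub_ne_zero.2 (h.injective.ne (by decide))
  have h3 : y 3 - y 0 ≠ 0 := sub_ne_zero.2 (h.injective.ne (by decide))
  have d12 : sphInv (y 2 - y 0) ≠ sphInv (y 1 - y 0) := fun he =>
    h.injective.ne (by decide : (2 : Fin 4) ≠ 1) (sub_left_injective (sphInv_injOn h2 h1 he))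
  have d13 : sphInv (y 3 - y 0) ≠ sphInv (y 1 - y 0) := fun he =>
    h.injective.ne (by decide : (3 : Fin 4) ≠ 1) (sub_left_injective (sphInv_injOn h3 h1 he))
  have d23 : sphInv (y 3 - y 0) ≠ sphInv (y 2 - y 0) := fun he =>
    h.injective.ne (by decide : (3 : Fin 4) ≠ 2) (sub_left_injective (sphInv_injOn h3 h2 he))
  have n1 := norm_pos_iff.2 h1
  have n2 := norm_pos_iff.2 h2
  have n3 := norm_pos_iff.2 h3
  have f1 := (h.inversion 0).2
  have f2 := (h.inversion 1).2
  have f3 := (h.inversion 2).2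
  simp only [field, Fin.sum_univ_three, sub_self, norm_zero, smul_zero, add_zero, zero_add,
    show Fin.succ (0 : Fin 3) = 1 from rfl, show Fin.succ (1 : Fin 3) = 2 from rfl,
    show Fin.succ (2 : Fin 3) = 3 from rfl] at f1 f2 f3
  have key := four_charges (a := sphInv (y 1 - y 0)) (b := sphInv (y 2 - y 0))
    (c := sphInv (y 3 - y 0))
    (d := 0) (w₁ := w 1 / ‖y 1 - y 0‖) (w₂ := w 2 / ‖y 2 - y 0‖) (w₃ := w 3 / ‖y 3 - y 0‖)
    (w₄ := -c) d12 d13 (sphInv_ne_zero h1).symm d23 (sphInv_ne_zero h2).symm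
    (sphInv_ne_zero h3).symm
    (div_ne_zero (h.charge_ne_zero 1) n1.ne') (div_ne_zero (h.charge_ne_zero 2) n2.ne')
    (div_ne_zero (h.charge_ne_zero 3) n3.ne') (neg_ne_zero.2 hc)
    (by rw [norm_sub_rev (sphInv (y 2 - y 0)), norm_sub_rev (sphInv (y 3 - y 0)), zero_sub,
          norm_neg, add_comm]
        simpa only [zero_sub] using f1)
    (by rw [norm_sub_rev (sphInv (y 3 - y 0)), zero_sub, norm_neg, add_comm]
        simpa only [zero_sub] using f2)
    (by rw [zero_sub, norm_neg, add_comm]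
        simpa only [zero_sub] using f3)
  rw [norm_sphInv_sub_sphInv h2 h1, norm_sphInv_sub_sphInv h3 h1, norm_sphInv_sub_sphInv h3 h2,
    zero_sub, zero_sub,
    zero_sub, norm_neg, norm_neg, norm_neg, norm_sphInv, norm_sphInv, norm_sphInv] at key
  simp only [sub_sub_sub_cancel_right] at key
  obtain ⟨k1, k2⟩ := key
  field_simp at k1 k2
  exact ⟨k1, k2⟩

theorem not_isBalanced_four_of_ne_zero [FiniteDimensional ℝ E] (y : Fin 4 → E) (w : Fin 4 → ℝ)
    {c : ℝ} (hc : c ≠ 0) : ¬ IsBalanced y w c := by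
  intro h
  obtain ⟨a1, a2⟩ := h.equilateral hc
  have b := ((h.comp_equiv (Equiv.swap 0 3)).equilateral hc).1
  have d := ((h.comp_equiv (Equiv.swap 0 2)).equilateral hc).2
  obtain ⟨e1, e2⟩ := (h.comp_equiv (Equiv.swap 0 1)).equilateral hc
  simp only [Function.comp_apply, Equiv.swap_apply_right,
    Equiv.swap_apply_of_ne_of_ne (by decide : (1 : Fin 4) ≠ 0) (by decide : (1 : Fin 4) ≠ 2),
    Equiv.swap_apply_of_ne_of_ne (by decide : (3 : Fin 4) ≠ 0) (by decide : (3 : Fin 4) ≠ 2),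
    Equiv.swap_apply_of_ne_of_ne (by decide : (2 : Fin 4) ≠ 0) (by decide : (2 : Fin 4) ≠ 1),
    Equiv.swap_apply_of_ne_of_ne (by decide : (3 : Fin 4) ≠ 0) (by decide : (3 : Fin 4) ≠ 1)]
    at d e1 e2
  have f0 := h.field_eq 0
  have hpos : 0 < ‖y 3 - y 0‖ :=
    norm_pos_iff.2 (sub_ne_zero.2 (h.injective.ne (by decide)))
  have b := ((h.comp_equiv (Equiv.swap 0 3)).equilateral hc).1
  simp only [Function.comp_apply, Equiv.swap_apply_right,
    Equiv.swap_apply_of_ne_of_ne (by decide : (1 : Fin 4) ≠ 0) (by decide : (1 : Fin 4) ≠ 3),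
    Equiv.swap_apply_of_ne_of_ne (by decide : (2 : Fin 4) ≠ 0) (by decide : (2 : Fin 4) ≠ 3),
    norm_sub_rev (y 0)] at b
  have r1 : ‖y 1 - y 0‖ = ‖y 3 - y 0‖ := by rw [← b, a1, d]
  have r21 : ‖(y 2 - y 0) - (y 1 - y 0)‖ = ‖y 3 - y 0‖ := by
    rw [sub_sub_sub_cancel_right, a1, d]
  have r31 : ‖(y 3 - y 0) - (y 1 - y 0)‖ = ‖y 3 - y 0‖ := by
    rw [sub_sub_sub_cancel_right, d]
  have r32 : ‖(y 3 - y 0) - (y 2 - y 0)‖ = ‖y 3 - y 0‖ := by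
    rw [sub_sub_sub_cancel_right, e2]
  simp only [field, Fin.sum_univ_four, sub_self, norm_zero, smul_zero, zero_add,
    norm_sub_rev (y 0), r1, e1] at f0
  have i21 := norm_sub_sq_real (y 2 - y 0) (y 1 - y 0)
  have i31 := norm_sub_sq_real (y 3 - y 0) (y 1 - y 0)
  have i32 := norm_sub_sq_real (y 3 - y 0) (y 2 - y 0)
  rw [r21, e1, r1] at i21
  rw [r31, r1] at i31
  rw [r32, e1] at i32
  have g1 := congrArg (fun v => ⟪y 1 - y 0, v⟫) f0
  have g2 := congrArg (fun v => ⟪y 2 - y 0, v⟫) f0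
  have g3 := congrArg (fun v => ⟪y 3 - y 0, v⟫) f0
  simp only [inner_add_right, inner_smul_right, inner_zero_right, real_inner_self_eq_norm_sq,
    r1, e1] at g1 g2 g3
  rw [real_inner_comm (y 2 - y 0), real_inner_comm (y 3 - y 0)] at g1
  rw [real_inner_comm (y 3 - y 0)] at g2
  set R := ‖y 3 - y 0‖
  -- All six distances equal `R`, so the edges at `y 0` have Gram matrix `R² / 2` times identity
  -- plus all-ones; `3/2, -1/2, -1/2` is the first row of its inverse, up to the factor `R²`.
  have hw : w 1 / R ^ 3 * R ^ 2 = 0 := by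
    linear_combination (3 / 2) * g1 - (1 / 2) * g2 - (1 / 2) * g3 +
      (1 / 4 * (w 1 / R ^ 3) - 3 / 4 * (w 2 / R ^ 3)) * i21 +
      (1 / 4 * (w 1 / R ^ 3) - 3 / 4 * (w 3 / R ^ 3)) * i31 +
      (1 / 4 * (w 2 / R ^ 3) + 1 / 4 * (w 3 / R ^ 3)) * i32
  have := h.charge_ne_zero 1
  revert hw
  positivity

theorem not_isBalanced_four [FiniteDimensional ℝ E] (y : Fin 4 → E) (w : Fin 4 → ℝ) (c : ℝ) :
    ¬ IsBalanced y w c := by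
  intro h
  rcases eq_or_ne c 0 with rfl | hc
  · exact not_isBalanced_three _ _ _ h.of_potential_zero
  · exact not_isBalanced_four_of_ne_zero y w hc h

theorem not_isBalanced_five [FiniteDimensional ℝ E] (y : Fin 5 → E) (w : Fin 5 → ℝ) :
    ¬ IsBalanced y w 0 := fun h => not_isBalanced_four _ _ _ h.of_potential_zero

theorem IsBalanced.card_le_one [FiniteDimensional ℝ E] {y : ι → E} {w : ι → ℝ} {c : ℝ}
    (h : IsBalanced y w c) (h5 : Fintype.card ι ≤ 5) (hc : Fintype.card ι = 5 → c = 0) :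
    Fintype.card ι ≤ 1 := by
  obtain ⟨n, hn, ⟨e⟩⟩ : ∃ n, Fintype.card ι = n ∧ Nonempty (Fin n ≃ ι) :=
    ⟨_, rfl, ⟨(Fintype.equivFin ι).symm⟩⟩
  have h' := h.comp_equiv e
  rw [hn] at h5 hc ⊢
  interval_cases n
  · simp
  · simp
  · exact absurd h' (not_isBalanced_two _ _ _)
  · exact absurd h' (not_isBalanced_three _ _ _)
  · exact absurd h' (not_isBalanced_four _ _ _)
  · obtain rfl := hc rfl
    exact absurd h' (not_isBalanced_five _ _)

end Balanced

/-! ### Passage to the limit along an ultrafilter. -/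

section Limit

variable {E : Type*} [NormedAddCommGroup E] [InnerProductSpace ℝ E] {ι α : Type*} [Fintype ι]

theorem exists_tendsto_or_tendsto_norm_atTop {F : Type*} [NormedAddCommGroup F] [ProperSpace F]
    (l : Ultrafilter α) (f : α → F) :
    (∃ L, Tendsto f l (𝓝 L)) ∨ Tendsto (fun n => ‖f n‖) l atTop := by
  by_cases h : ∃ R : ℝ, ∀ᶠ n in l, ‖f n‖ ≤ R
  · obtain ⟨R, hR⟩ := h
    obtain ⟨L, -, hL⟩ := (isCompact_closedBall (0 : F) R).ultrafilter_le_nhds' (l.map f)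
      (show ∀ᶠ n in l, f n ∈ Metric.closedBall (0 : F) R from
        hR.mono fun n hn => mem_closedBall_zero_iff.2 hn)
    exact Or.inl ⟨L, hL⟩
  · right
    push Not at h
    exact tendsto_atTop.2 fun R => (h R).mono fun n hn => hn.le

theorem exists_tendsto_of_norm_le {F : Type*} [NormedAddCommGroup F] [ProperSpace F]
    (l : Ultrafilter α) {f : α → F} {g : α → ℝ} {L : ℝ} (hg : Tendsto g l (𝓝 L))
    (h : ∀ n, ‖f n‖ ≤ g n) : ∃ L, Tendsto f l (𝓝 L) := by
  refine (exists_tendsto_or_tendsto_norm_atTop l f).resolve_right fun hf => ?_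
  exact not_tendsto_atTop_of_tendsto_nhds hg (tendsto_atTop_mono h hf)

/-- Charges `w n` at the points `y n`, normalised at the scale of the pair `a, b`, with `S` the
set of the non-negligible charges, are not asymptotically balanced. -/
theorem not_asymptotically_balanced_of_normalized [FiniteDimensional ℝ E] (l : Ultrafilter α)
    (h5 : Fintype.card ι ≤ 5) {y : α → ι → E} {w : α → ι → ℝ} {S : Set ι} {a b : ι}
    (hle : ∀ n i j, i ≠ j → |w n j| ≤ ‖y n i - y n j‖)
    (hsep : ∀ j ∈ S, ∀ i, i ≠ j → ∀ᶠ n in l, 1 ≤ ‖y n i - y n j‖)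
    (hsmall : ∀ j ∉ S, ∀ i, i ≠ j → Tendsto (fun n => |w n j| / ‖y n i - y n j‖) l (𝓝 0))
    (hlarge : ∀ j ∈ S, ∃ i, i ≠ j ∧ ¬ Tendsto (fun n => |w n j| / ‖y n i - y n j‖) l (𝓝 0))
    (hpot : ∀ i, Tendsto (fun n => potential (y n) (w n) i) l (𝓝 0))
    (hforce : ∀ i, Tendsto (fun n => w n i • field (y n) (w n) i) l (𝓝 0))
    (haS : a ∈ S) (hab : b ≠ a) (hya : ∀ n, y n a = 0) (hyb : ∀ n, ‖y n b‖ = 1) : False := by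
  classical
  set C : ι → Prop := fun i => ∃ L, Tendsto (fun n => y n i) l (𝓝 L) with hC
  have hCa : C a := ⟨0, by simp [hya]⟩
  have hCb : C b := exists_tendsto_of_norm_le l (tendsto_const_nhds (x := (1 : ℝ)))
    fun n => (hyb n).le
  have hdiv : ∀ j, ¬ C j → Tendsto (fun n => ‖y n j‖) l atTop := fun j hj =>
    (exists_tendsto_or_tendsto_norm_atTop l _).resolve_left hj
  have hY : ∀ i, ∃ L, C i → Tendsto (fun n => y n i) l (𝓝 L) := fun i => by
    by_cases h : C i
    · exact ⟨h.choose, fun _ => h.choose_spec⟩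
    · exact ⟨0, fun h' => absurd h' h⟩
  choose Y hY using hY
  have hW : ∀ i, ∃ L, C i → Tendsto (fun n => w n i) l (𝓝 L) := fun i => by
    by_cases h : C i
    · rcases eq_or_ne i a with rfl | hia
      · obtain ⟨L, hL⟩ := exists_tendsto_of_norm_le l (tendsto_const_nhds (x := (1 : ℝ)))
          (f := fun n => w n i) fun n => by
            have := hle n b i hab
            rwa [hya, sub_zero, hyb] at this
        exact ⟨L, fun _ => hL⟩
      · obtain ⟨L, hL⟩ := exists_tendsto_of_norm_le l (hY i h).norm
          (f := fun n => w n i) fun n => by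
            have := hle n a i hia.symm
            rwa [hya, zero_sub, norm_neg] at this
        exact ⟨L, fun _ => hL⟩
    · exact ⟨0, fun h' => absurd h' h⟩
  choose W hW using hW
  have hYsep : ∀ i j, C i → C j → j ∈ S → i ≠ j → 1 ≤ ‖Y i - Y j‖ := fun i j hi hj hjS hij =>
    ge_of_tendsto ((hY i hi).sub (hY j hj)).norm (hsep j hjS i hij)
  set K : ι → Prop := fun i => i ∈ S ∧ C i with hK
  -- Distances from a charge in `S` are at least 1, so a vanishing limit charge would be negligible.
  have hWne : ∀ i, K i → W i ≠ 0 := fun i hi h0 => by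
    obtain ⟨k, hki, hk⟩ := hlarge i hi.1
    refine hk (squeeze_zero' (Eventually.of_forall fun n => by positivity) ?_
      (by simpa [h0] using (hW i hi.2).abs))
    filter_upwards [hsep i hi.1 k hki] with n hn
    exact div_le_self (abs_nonneg _) hn
  have habs : ∀ n i j, |w n j / ‖y n i - y n j‖| = |w n j| / ‖y n i - y n j‖ := fun n i j => by
    rw [abs_div, abs_norm]
  have hT1 : ∀ n i j, i ≠ j → |w n j / ‖y n i - y n j‖| ≤ 1 := fun n i j hij => by
    rw [habs]
    exact div_le_one_of_le₀ (hle n i j hij) (norm_nonneg _)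
  -- the potentials of the points outside `K` become constant
  have hc : ∀ j, ∃ c, ¬ K j → ∀ i, C i →
      Tendsto (fun n => w n j / ‖y n i - y n j‖) l (𝓝 c) := fun j => by
    by_cases hjS : j ∈ S
    · by_cases hj : C j
      · exact ⟨0, fun h => absurd ⟨hjS, hj⟩ h⟩
      · have hja : a ≠ j := fun h => hj (h ▸ hCa)
        obtain ⟨c, hc⟩ := exists_tendsto_of_norm_le l (tendsto_const_nhds (x := (1 : ℝ)))
          (f := fun n => w n j / ‖y n a - y n j‖) fun n => hT1 n a j hja
        refine ⟨c, fun _ i hi => ?_⟩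
        have hij : i ≠ j := fun h => hj (h ▸ hi)
        have hb : Tendsto (fun n => ‖y n i‖ / ‖y n j‖) l (𝓝 0) :=
          (hY i hi).norm.div_atTop (hdiv j hj)
        -- A charge escaping to infinity has the same limiting potential at every convergent point
        -- as at `a`, since `‖y i‖ / ‖y j‖ → 0`.
        have hd : Tendsto (fun n => w n j / ‖y n i - y n j‖ - w n j / ‖y n a - y n j‖) l (𝓝 0) := by
          refine squeeze_zero_norm' ?_ hb
          filter_upwards [hsep j hjS i hij, hsep j hjS a hja] with n h1 h2
          have e := hT1 n i j hij
          have key : w n j / ‖y n i - y n j‖ - w n j / ‖y n a - y n j‖ =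
              w n j / ‖y n i - y n j‖ * ((‖y n j‖ - ‖y n i - y n j‖) / ‖y n j‖) := by
            rw [hya, zero_sub, norm_neg] at h2 ⊢
            field_simp
          rw [key, Real.norm_eq_abs, abs_mul, abs_div (_ - _), abs_norm]
          have h3 : |‖y n j‖ - ‖y n i - y n j‖| ≤ ‖y n i‖ := by
            rw [abs_sub_comm, ← norm_neg (y n j)]
            refine (abs_norm_sub_norm_le _ _).trans_eq ?_
            congr 1; abel
          calc _ ≤ 1 * (|‖y n j‖ - ‖y n i - y n j‖| / ‖y n j‖) := by gcongr
            _ ≤ _ := by rw [one_mul]; gcongr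
        simpa using hd.add hc
    · refine ⟨0, fun _ i _ => ?_⟩
      rcases eq_or_ne i j with rfl | hij
      · simp
      · exact (tendsto_zero_iff_abs_tendsto_zero _).2 (by
          simpa only [Function.comp_def, habs] using hsmall j hjS i hij)
  choose c hc using hc
  have hpotlim : ∀ i, C i → ∑ j : {j // K j}, W j / ‖Y i - Y j‖ +
      ∑ j : {j // ¬ K j}, c j = 0 := fun i hi => by
    have h := hpot i
    simp only [potential, ← Fintype.sum_subtype_add_sum_subtype K] at h
    refine tendsto_nhds_unique (Tendsto.add (tendsto_finsetSum _ fun j _ => ?_)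
      (tendsto_finsetSum _ fun j _ => hc j j.2 i hi)) h
    rcases eq_or_ne i j with hij | hij
    · simp [← hij]
    · exact (hW j j.2.2).div ((hY i hi).sub (hY j j.2.2)).norm
        (by have := hYsep i j hi j.2.2 j.2.1 hij; positivity)
  have hfieldlim : ∀ i, K i → ∑ j : {j // K j}, (W j / ‖Y i - Y j‖ ^ 3) • (Y j - Y i) = 0 := by
    intro i hi
    have hf : Tendsto (fun n => field (y n) (w n) i) l (𝓝 0) := by
      have := ((hW i hi.2).inv₀ (hWne i hi)).smul (hforce i)
      rw [smul_zero] at this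
      refine this.congr' ?_
      filter_upwards [(hW i hi.2).eventually_ne (hWne i hi)] with n hn
      rw [inv_smul_smul₀ hn]
    simp only [field, ← Fintype.sum_subtype_add_sum_subtype K] at hf
    have hA : Tendsto (fun n => ∑ j : {j // K j}, (w n j / ‖y n i - y n j‖ ^ 3) • (y n j - y n i)) l
        (𝓝 (∑ j : {j // K j}, (W j / ‖Y i - Y j‖ ^ 3) • (Y j - Y i))) := by
      refine tendsto_finsetSum _ fun j _ => ?_
      rcases eq_or_ne i j with hij | hij
      · simp [← hij]
      · exact ((hW j j.2.2).div (((hY i hi.2).sub (hY j j.2.2)).norm.pow 3)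
          (by have := hYsep i j hi.2 j.2.2 j.2.1 hij; positivity)).smul
          ((hY j j.2.2).sub (hY i hi.2))
    -- Each outside field has norm `(|w| / r) (1 / r)`: for an escaping charge the first factor is
    -- at most 1 and the second tends to 0; for a negligible one it is the reverse.
    have hB : Tendsto (fun n => ∑ j : {j // ¬ K j}, (w n j / ‖y n i - y n j‖ ^ 3) •
        (y n j - y n i)) l (𝓝 (∑ j : {j // ¬ K j}, (0 : E))) := by
      refine tendsto_finsetSum _ fun j _ => ?_
      obtain ⟨j, hj⟩ := j
      have hij : i ≠ j := fun h => hj (h ▸ hi)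
      have hnorm : ∀ᶠ n in l, ‖(w n j / ‖y n i - y n j‖ ^ 3) • (y n j - y n i)‖ =
          |w n j| / ‖y n i - y n j‖ * (1 / ‖y n i - y n j‖) := by
        filter_upwards [hsep i hi.1 j hij.symm] with n hn
        rw [norm_sub_rev] at hn
        rw [norm_smul, norm_sub_rev (y n j), Real.norm_eq_abs, abs_div, abs_pow, abs_norm]
        field_simp
      by_cases hjS : j ∈ S
      · have hjC : ¬ C j := fun h => hj ⟨hjS, h⟩
        have htop : Tendsto (fun n => ‖y n i - y n j‖) l atTop := by
          have := tendsto_atTop_add_right_of_le' l (-(‖Y i‖ + 1)) (hdiv j hjC)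
            (g := fun n => -‖y n i‖) (by
              filter_upwards [(hY i hi.2).norm.eventually_le_const (lt_add_one _)] with n hn
              linarith)
          refine tendsto_atTop_mono (fun n => ?_) this
          have := norm_sub_norm_le (y n j) (y n i)
          rw [norm_sub_rev]; linarith
        refine squeeze_zero_norm' ?_ (tendsto_const_nhds (x := (1 : ℝ)) |>.div_atTop htop)
        filter_upwards [hnorm] with n hn
        rw [hn]
        have := hT1 n i j hij
        rw [habs] at this
        exact mul_le_of_le_one_left (by positivity) this
      · refine squeeze_zero_norm' ?_ (hsmall j hjS i hij)
        filter_upwards [hnorm, hsep i hi.1 j hij.symm] with n hn h1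
        rw [norm_sub_rev] at h1
        rw [hn]
        exact mul_le_of_le_one_right (by positivity) (by rw [div_le_one (by linarith)]; exact h1)
    simpa using tendsto_nhds_unique (hA.add hB) hf
  have hbal : IsBalanced (fun j : {j // K j} => Y j) (fun j => W j) (-∑ j : {j // ¬ K j}, c j) := by
    refine ⟨fun i j hij => ?_, fun j => hWne j j.2, fun i => ?_, fun i => hfieldlim i i.2⟩
    · by_contra hne
      have := hYsep i j i.2.2 j.2.2 j.2.1 (fun h => hne (Subtype.ext h))
      have h0 : Y i - Y j = 0 := sub_eq_zero.2 hij
      rw [h0, norm_zero] at this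
      linarith
    · exact eq_neg_of_add_eq_zero_left (hpotlim i i.2.2)
  have hcard : Fintype.card {j // K j} ≤ 1 := by
    -- With five charges in the cluster none is left outside, so the common potential is an empty
    -- sum.
    refine hbal.card_le_one ((Fintype.card_subtype_le K).trans h5) fun h => ?_
    have := Fintype.card_subtype_compl K
    have he : Fintype.card {j // ¬ K j} = 0 := by omega
    have := Fintype.card_eq_zero_iff.1 he
    simp
  have hsub := Fintype.card_le_one_iff_subsingleton.1 hcard
  have hKa : K a := ⟨haS, hCa⟩
  have hsum : ∀ i, ∑ j : {j // K j}, W j / ‖Y i - Y j‖ = W a / ‖Y i - Y a‖ := fun i =>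
    Fintype.sum_subsingleton _ (⟨a, hKa⟩ : {j // K j})
  -- For `K = {a}`, the potential at `a` makes the outside constant vanish; the potential at `b`
  -- then gives `W a = 0`.
  have h1 := hpotlim a hCa
  have h2 := hpotlim b hCb
  rw [hsum, sub_self, norm_zero, div_zero, zero_add] at h1
  rw [hsum, h1, add_zero, div_eq_zero_iff] at h2
  have := hYsep b a hCb hCa haS hab
  rcases h2 with h2 | h2
  · exact hWne a hKa h2
  · linarith

end Limit

/-! ### Choice of scale. -/

section Normalization

variable {E : Type*} [NormedAddCommGroup E] [InnerProductSpace ℝ E] {ι α : Type*} [Fintype ι]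

omit [InnerProductSpace ℝ E] in
theorem potential_mul (x : ι → E) (t : ℝ) (u : ι → ℝ) (i : ι) :
    potential x (fun j => t * u j) i = t * potential x u i := by
  simp only [potential, Finset.mul_sum, mul_div_assoc]

theorem field_mul (x : ι → E) (t : ℝ) (u : ι → ℝ) (i : ι) :
    field x (fun j => t * u j) i = t • field x u i := by
  simp only [field, Finset.smul_sum, mul_div_assoc, smul_smul]

theorem norm_smul_sub_sub {t : ℝ} (ht : 0 < t) (x z v : E) :
    ‖t • (x - v) - t • (z - v)‖ = t * ‖x - z‖ := by
  rw [← smul_sub, sub_sub_sub_cancel_right, norm_smul, Real.norm_of_nonneg ht.le]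

theorem potential_similarity (x : ι → E) (v : E) {t : ℝ} (ht : 0 < t) (u : ι → ℝ) (i : ι) :
    potential (fun j => t • (x j - v)) (fun j => t * u j) i = potential x u i := by
  simp only [potential, norm_smul_sub_sub ht, mul_div_mul_left _ _ ht.ne']

/-- The force, unlike the field, is invariant when lengths and charges scale together; hence the
hypothesis on `u i • field` in the limit argument. -/
theorem field_similarity (x : ι → E) (v : E) {t : ℝ} (ht : 0 < t) (u : ι → ℝ) (i : ι) :
    (t * u i) • field (fun j => t • (x j - v)) (fun j => t * u j) i = u i • field x u i := by
  simp only [field, norm_smul_sub_sub ht, Finset.smul_sum]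
  refine Finset.sum_congr rfl fun j _ => ?_
  rw [← smul_sub, sub_sub_sub_cancel_right, smul_smul, smul_smul, smul_smul]
  congr 1
  rcases eq_or_ne ‖x i - x j‖ 0 with h | h
  · simp [h]
  · field_simp

theorem not_asymptotically_balanced [FiniteDimensional ℝ E] (l : Ultrafilter α)
    (h5 : Fintype.card ι ≤ 5) {x : α → ι → E} {u : α → ι → ℝ}
    (hinj : ∀ n, Function.Injective (x n))
    (hle : ∀ n i j, i ≠ j → |u n j| ≤ ‖x n i - x n j‖)
    (hmax : ∀ n, ∃ i j, i ≠ j ∧ |u n j| = ‖x n i - x n j‖)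
    (hpot : ∀ i, Tendsto (fun n => potential (x n) (u n) i) l (𝓝 0))
    (hforce : ∀ i, Tendsto (fun n => u n i • field (x n) (u n) i) l (𝓝 0)) : False := by
  set S : Set ι := {j | ∃ i, i ≠ j ∧
    ¬ Tendsto (fun n => |u n j| / ‖x n i - x n j‖) l (𝓝 0)} with hS
  have hpos : ∀ n i j, i ≠ j → 0 < ‖x n i - x n j‖ := fun n i j hij =>
    norm_pos_iff.2 (sub_ne_zero.2 ((hinj n).ne hij))
  obtain ⟨j₀, hj₀⟩ : S.Nonempty := by
    have h : ∀ᶠ n in l, ∃ p : ι × ι, p.1 ≠ p.2 ∧ |u n p.2| = ‖x n p.1 - x n p.2‖ :=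
      Eventually.of_forall fun n => by
        obtain ⟨i, j, h⟩ := hmax n
        exact ⟨(i, j), h⟩
    obtain ⟨⟨i, j⟩, hp⟩ := Ultrafilter.eventually_exists_iff.1 h
    obtain ⟨-, hij, -⟩ := hp.exists
    refine ⟨j, i, hij, fun h0 => ?_⟩
    have h1 : Tendsto (fun n => |u n j| / ‖x n i - x n j‖) l (𝓝 1) := by
      refine tendsto_const_nhds.congr' ?_
      filter_upwards [hp] with n hn
      rw [hn.2, div_self (hpos n i j hij).ne']
    exact one_ne_zero (tendsto_nhds_unique h1 h0)
  -- There are finitely many pairs, so the ultrafilter selects one that realises the minimal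
  -- distance for almost every `n`.
  obtain ⟨⟨a, b⟩, hab⟩ : ∃ p : ι × ι, ∀ᶠ n in l, (p.1 ∈ S ∧ p.2 ≠ p.1) ∧
      ∀ j ∈ S, ∀ i, i ≠ j → ‖x n p.2 - x n p.1‖ ≤ ‖x n i - x n j‖ := by
    refine Ultrafilter.eventually_exists_iff.1 (Eventually.of_forall fun n => ?_)
    obtain ⟨i₀, hi₀, -⟩ := id hj₀
    obtain ⟨p, hp, hmin⟩ := Set.exists_min_image {p : ι × ι | p.1 ∈ S ∧ p.2 ≠ p.1}
      (fun p => ‖x n p.2 - x n p.1‖) (Set.toFinite _) ⟨(j₀, i₀), hj₀, hi₀⟩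
    exact ⟨p, hp, fun j hj i hij => hmin (j, i) ⟨hj, hij⟩⟩
  obtain ⟨-, ⟨haS, hba⟩, -⟩ := hab.exists
  dsimp only at haS hba hab
  have ht : ∀ n, 0 < ‖x n b - x n a‖⁻¹ := fun n => inv_pos.2 (hpos n b a hba)
  refine not_asymptotically_balanced_of_normalized l h5
    (y := fun n i => ‖x n b - x n a‖⁻¹ • (x n i - x n a))
    (w := fun n i => ‖x n b - x n a‖⁻¹ * u n i) (S := S) (a := a) (b := b)
    ?_ ?_ ?_ ?_ ?_ ?_ haS hba ?_ ?_
  · intro n i j hij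
    rw [norm_smul_sub_sub (ht n), abs_mul, abs_of_pos (ht n)]
    exact mul_le_mul_of_nonneg_left (hle n i j hij) (ht n).le
  · intro j hj i hij
    filter_upwards [hab] with n hn
    rw [norm_smul_sub_sub (ht n), ← div_eq_inv_mul, one_le_div (hpos n b a hba)]
    exact hn.2 j hj i hij
  · intro j hj i hij
    simp only [norm_smul_sub_sub (ht _), abs_mul, abs_of_pos (ht _), mul_div_mul_left _ _ (ht _).ne']
    by_contra h
    exact hj ⟨i, hij, h⟩
  · rintro j ⟨i, hij, h⟩
    refine ⟨i, hij, ?_⟩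
    simpa only [norm_smul_sub_sub (ht _), abs_mul, abs_of_pos (ht _),
      mul_div_mul_left _ _ (ht _).ne'] using h
  · intro i
    simpa only [potential_similarity _ _ (ht _)] using hpot i
  · intro i
    simpa only [field_similarity _ _ (ht _)] using hforce i
  · intro n
    simp
  · intro n
    rw [norm_smul, Real.norm_of_nonneg (ht n).le, inv_mul_cancel₀ (hpos n b a hba).ne']

end Normalization

/-! ### Translation of the matrix expressions into potentials and forces. -/

section Gradient

theorem hasGradientAt_one_div_norm_sub {E : Type*} [NormedAddCommGroup E] [InnerProductSpace ℝ E]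
    [CompleteSpace E] {z v : E} (h : z ≠ v) :
    HasGradientAt (fun y => 1 / ‖y - v‖) ((1 / ‖z - v‖ ^ 3) • (v - z)) z := by
  have hn : ‖z - v‖ ≠ 0 := norm_ne_zero_iff.2 (sub_ne_zero.2 h)
  have h1 := (((hasFDerivAt_id (𝕜 := ℝ) z).sub_const v).norm_sq).sqrt (pow_ne_zero 2 hn)
  have hs : √(‖z - v‖ ^ 2) = ‖z - v‖ := Real.sqrt_sq (norm_nonneg _)
  have h2 := (hasDerivAt_inv (x := √(‖z - v‖ ^ 2)) (by rwa [hs])).comp_hasFDerivAt z h1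
  rw [hasGradientAt_iff_hasFDerivAt]
  convert! h2 using 1
  · ext y
    simp [Real.sqrt_sq]
  · ext y
    simp [hs]
    field_simp
    ring

variable {p m : ℕ}

theorem dmatA_apply {x : Fin p → EuclideanSpace ℝ (Fin m)} (hx : Function.Injective x)
    (k i j : Fin p) :
    dmatA x k i j = (if i = k then (1 / ‖x k - x j‖ ^ 3) • (x j - x k) else 0) +
      (if j = k then (1 / ‖x k - x i‖ ^ 3) • (x i - x k) else 0) := by
  simp only [dmatA, matA, Matrix.of_apply]
  rcases eq_or_ne i j with rfl | hij
  · simp only [if_true]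
    rcases eq_or_ne i k with rfl | hik
    · simp
    · simp [hik]
  · simp only [hij, if_false]
    rcases eq_or_ne i k with rfl | hik
    · simp only [Function.update_self, Function.update_of_ne hij.symm, if_true, hij.symm, if_false,
        add_zero]
      exact (hasGradientAt_one_div_norm_sub (hx.ne hij)).gradient
    · rcases eq_or_ne j k with rfl | hjk
      · simp only [Function.update_self, Function.update_of_ne hij, if_true, hij, if_false,
          zero_add, norm_sub_rev (x i)]
        exact (hasGradientAt_one_div_norm_sub (hx.ne hij.symm)).gradient
      · simp [hik, hjk]

theorem quadForm_dmatA {x : Fin p → EuclideanSpace ℝ (Fin m)} (hx : Function.Injective x)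
    (U : Fin p → ℝ) (k : Fin p) :
    quadForm (dmatA x k) U = (2 : ℝ) • U k • field x U k := by
  simp only [quadForm, dmatA_apply hx, smul_add, Finset.sum_add_distrib, smul_ite, smul_zero]
  rw [Finset.sum_comm]
  simp only [Finset.sum_ite_eq', Finset.mem_univ, if_true]
  rw [two_smul, field, Finset.smul_sum]
  congr 1 <;> refine Finset.sum_congr rfl fun j _ => ?_ <;> rw [smul_smul, smul_smul] <;>
    congr 1 <;> ring

theorem mulVec_matA (x : Fin p → EuclideanSpace ℝ (Fin m)) (U : Fin p → ℝ) (i : Fin p) :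
    (matA x).mulVec U i = potential x U i := by
  simp only [Matrix.mulVec, dotProduct, matA, Matrix.of_apply, potential]
  refine Finset.sum_congr rfl fun j _ => ?_
  rcases eq_or_ne i j with rfl | hij
  · simp
  · rw [if_neg hij]; ring

end Gradient

/-! ### Normalised counterexamples and conclusion. -/

theorem exists_normalized_of_lt {p m : ℕ} (hp : p ≤ 5) {x : Fin p → EuclideanSpace ℝ (Fin m)}
    (hx : Function.Injective x) {U : Fin p → ℝ} {ε : ℝ} (hε : 0 < ε) (hε1 : ε ≤ 1)
    (hlt : ‖WithLp.toLp 2 ((matA x).mulVec U)‖ ^ 2 + ⨆ k : Fin p, ‖quadForm (dmatA x k) U‖ <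
      ε ^ 2 / 25 * ∑ i, ∑ j ∈ Finset.univ.filter (fun j => j ≠ i), U j ^ 2 / ‖x i - x j‖ ^ 2) :
    ∃ u : Fin p → ℝ, (∀ i j, i ≠ j → |u j| ≤ ‖x i - x j‖) ∧
      (∃ i j, i ≠ j ∧ |u j| = ‖x i - x j‖) ∧ (∀ i, ‖potential x u i‖ ≤ ε) ∧
      ∀ i, ‖u i • field x u i‖ ≤ ε := by
  have hr : ∀ i j, i ≠ j → 0 < ‖x i - x j‖ := fun i j hij =>
    norm_pos_iff.2 (sub_ne_zero.2 (hx.ne hij))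
  have hsup : 0 ≤ ⨆ k : Fin p, ‖quadForm (dmatA x k) U‖ :=
    Real.iSup_nonneg fun k => norm_nonneg _
  have hsum : 0 < ∑ i, ∑ j ∈ Finset.univ.filter (fun j => j ≠ i), U j ^ 2 / ‖x i - x j‖ ^ 2 :=
    pos_of_mul_pos_right ((by positivity : (0 : ℝ) ≤ _).trans_lt hlt) (by positivity)
  obtain ⟨i₁, -, hi₁⟩ := Finset.exists_ne_zero_of_sum_ne_zero hsum.ne'
  obtain ⟨j₁, hj₁, hij₁⟩ := Finset.exists_ne_zero_of_sum_ne_zero hi₁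
  have hne₁ : j₁ ≠ i₁ := (Finset.mem_filter.1 hj₁).2
  obtain ⟨⟨i₀, j₀⟩, hne₀, hmax⟩ := Set.exists_max_image {q : Fin p × Fin p | q.1 ≠ q.2}
    (fun q => |U q.2| / ‖x q.1 - x q.2‖) (Set.toFinite _) ⟨(i₁, j₁), hne₁.symm⟩
  dsimp only at hne₀ hmax
  -- Dividing `U` by `M` makes the largest ratio 1. The sum has at most `25` terms, each at most
  -- `M²`, so the left side is below `(ε M)²`; potentials scale linearly and forces quadratically,
  -- giving `ε` and `ε² ≤ ε`.
  set M := |U j₀| / ‖x i₀ - x j₀‖ with hMdef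
  have hle : ∀ i j, i ≠ j → |U j| / ‖x i - x j‖ ≤ M := fun i j hij => hmax (i, j) hij
  have hM : 0 < M := by
    refine lt_of_lt_of_le ?_ (hle i₁ j₁ hne₁.symm)
    have : U j₁ ≠ 0 := fun h => hij₁ (by simp [h])
    have := hr i₁ j₁ hne₁.symm
    positivity
  have hsumle : ∑ i, ∑ j ∈ Finset.univ.filter (fun j => j ≠ i), U j ^ 2 / ‖x i - x j‖ ^ 2 ≤
      25 * M ^ 2 := by
    calc _ ≤ ∑ i : Fin p, ∑ j ∈ Finset.univ.filter (fun j => j ≠ i), M ^ 2 := by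
          refine Finset.sum_le_sum fun i _ => Finset.sum_le_sum fun j hj => ?_
          rw [← sq_abs (U j), ← div_pow]
          exact pow_le_pow_left₀ (by positivity) (hle i j (Finset.mem_filter.1 hj).2.symm) 2
      _ ≤ ∑ i : Fin p, ∑ j : Fin p, M ^ 2 := Finset.sum_le_sum fun i _ =>
          Finset.sum_le_sum_of_subset_of_nonneg (Finset.filter_subset _ _) fun _ _ _ => by positivity
      _ = (p * p : ℝ) * M ^ 2 := by simp [mul_assoc]
      _ ≤ (5 * 5 : ℝ) * M ^ 2 := by
          have : (p : ℝ) ≤ 5 := by exact_mod_cast hp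
          gcongr
      _ = _ := by norm_num
  have htot : ‖WithLp.toLp 2 ((matA x).mulVec U)‖ ^ 2 + ⨆ k : Fin p, ‖quadForm (dmatA x k) U‖ <
      (ε * M) ^ 2 := by
    refine hlt.trans_le ((mul_le_mul_of_nonneg_left hsumle (by positivity)).trans_eq ?_)
    ring
  refine ⟨fun j => M⁻¹ * U j, fun i j hij => ?_, ⟨i₀, j₀, hne₀, ?_⟩, fun i => ?_, fun i => ?_⟩
  · have := hle i j hij
    rw [div_le_iff₀ (hr i j hij)] at this
    rw [abs_mul, abs_inv, abs_of_pos hM, inv_mul_le_iff₀ hM]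
    exact this
  · have hU : |U j₀| = M * ‖x i₀ - x j₀‖ := by
      rw [hMdef, div_mul_cancel₀ _ (hr i₀ j₀ hne₀).ne']
    rw [abs_mul, abs_inv, abs_of_pos hM, inv_mul_eq_iff_eq_mul₀ hM.ne', hU]
  · have h1 : potential x U i ^ 2 ≤ (ε * M) ^ 2 := by
      refine le_trans ?_ ((le_add_of_nonneg_right hsup).trans htot.le)
      rw [EuclideanSpace.norm_sq_eq]
      simp only [mulVec_matA, Real.norm_eq_abs, sq_abs]
      exact Finset.single_le_sum (f := fun i => potential x U i ^ 2) (fun _ _ => sq_nonneg _)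
        (Finset.mem_univ i)
    have h2 := abs_le_of_sq_le_sq h1 (by positivity)
    rw [potential_mul, norm_mul, Real.norm_of_nonneg (inv_nonneg.2 hM.le), inv_mul_le_iff₀ hM, mul_comm M]
    exact h2
  · have h1 : ‖U i • field x U i‖ ≤ (ε * M) ^ 2 := by
      have h := le_ciSup (Set.finite_range fun k => ‖quadForm (dmatA x k) U‖).bddAbove i
      simp only [quadForm_dmatA hx] at h htot
      rw [norm_smul, Real.norm_two] at h
      nlinarith [norm_nonneg (U i • field x U i),
        sq_nonneg ‖WithLp.toLp 2 ((matA x).mulVec U)‖]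
    rw [field_mul, smul_smul, mul_right_comm, mul_smul, norm_smul, Real.norm_of_nonneg (by positivity)]
    calc M⁻¹ * M⁻¹ * ‖U i • field x U i‖ ≤ M⁻¹ * M⁻¹ * (ε * M) ^ 2 := by gcongr
      _ = ε * ε := by field_simp
      _ ≤ ε := mul_le_of_le_one_left hε.le hε1

theorem conjecture_of_le_five {p : ℕ} (hp : p ≤ 5) (m : ℕ) : Conjecture p m := by
  by_contra hcon
  have key : ∀ n : ℕ, ∃ x : Fin p → EuclideanSpace ℝ (Fin m), ∃ u : Fin p → ℝ,
      Function.Injective x ∧ (∀ i j, i ≠ j → |u j| ≤ ‖x i - x j‖) ∧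
      (∃ i j, i ≠ j ∧ |u j| = ‖x i - x j‖) ∧ (∀ i, ‖potential x u i‖ ≤ 1 / ((n : ℝ) + 1)) ∧
      ∀ i, ‖u i • field x u i‖ ≤ 1 / ((n : ℝ) + 1) := fun n => by
    by_contra hn
    refine hcon ⟨(1 / ((n : ℝ) + 1)) ^ 2 / 25, by positivity, fun x hx U => ?_⟩
    by_contra hlt
    obtain ⟨u, hu⟩ := exists_normalized_of_lt hp hx (by positivity)
      (by rw [div_le_one (by positivity)]; linarith [n.cast_nonneg (α := ℝ)]) (not_le.1 hlt)
    exact hn ⟨x, u, hx, hu⟩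
  choose x u hx hle hmax hpot hforce using key
  have hlim : Tendsto (fun n : ℕ => 1 / ((n : ℝ) + 1)) (hyperfilter ℕ) (𝓝 0) :=
    tendsto_one_div_add_atTop_nhds_zero_nat.mono_left Nat.hyperfilter_le_atTop
  exact not_asymptotically_balanced (hyperfilter ℕ) (by simpa using hp) hx hle hmax
    (fun i => squeeze_zero_norm (fun n => hpot n i) hlim)
    (fun i => squeeze_zero_norm (fun n => hforce n i) hlim)

end BahriXu

theorem mainTheorem4 (p : ℕ) (hp : p = 4 ∨ p = 5) (m : ℕ) : BahriXu.Conjecture p m :=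
  BahriXu.conjecture_of_le_five (by omega) m
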